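/- **Setting.** Let $\mathcal X$ be a finite set of types, $r\ge 0$, and let $\mathcal Y_0=\{0,1,\dots,r\}$ be the set of options. Let $p_{y|x}\in\mathbb R$ ($x\in\mathcal X$, $y\in\mathcal Y_0$) be given choice probabilities, and let $\mathcal U=\{U\in\mathbb R^{\mathcal X\times\mathcal Y_0}: U_{x0}=0\ \forall x\}$. Put $d=\binom{r+1}{2}$ and index the coordinates $l=1,\dots,d$ of a vector $\Delta\epsilon\in\mathbb R^d$ by the pairs $(a,b)$ of options in the order $(1,0),\dots,(r,0),(1,2),\dots,(1,r),(2,3),\dots,(r-1,r)$; coordinate $(a,b)$ stands for the taste-shock difference $\epsilon_a-\epsilon_b$. For $l=(a,b)$ let $c_{x,l}(U)=U_{xb}-U_{xa}$. For a probability measure $\mu$ on $\mathbb R^d$ let $$\kappa(U,\mu,y)=\mu\{e\in\mathbb R^d:\ e_{(y,b)}\ge c_{x,(y,b)}(U)\ \text{and}\ e_{(a,y)}\le c_{x,(a,y)}(U)\ \text{for all coordinates } (y,b),(a,y)\}$$ be the predicted probability that type $x$ chooses $y$. Let $\Delta\epsilon^y\in\mathbb R^r$ be the subvector of the coordinates whose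 pair contains $y$, in increasing order. **Classes of distributions.** $\Delta\mathcal F$ is the set of families $\{\Delta F_x\}_{x\in\mathcal X}$ of distribution functions of probability measures on $\mathbb R^d$ (the linear relations between the coordinates of $\Delta\epsilon$ are not imposed), subject to one of the following regularity requirements, fixed throughout: none; $\Delta F_x$ is continuous; all one-dimensional marginals are absolutely continuous; the laws of all subvectors $\Delta\epsilon^y$ are absolutely continuous on $\mathbb R^r$. The result holds for each of the four. Let $\Delta F_{x,l}$ be the $l$-th marginal and $\Delta F^y_x$ the distribution function of $\Delta\epsilon^y$. Let $S$ be any set of the following restrictions, and let $\Delta\mathcal F^\dagger\subseteq\Delta\mathcal F$ be the class of families satisfying all restrictions in $S$: * 5.1 $\Delta F_x(a)=\Delta F_{\tilde x}(a)$ for all $a\in\bar{\mathbb R}^d$ and $x,\tilde x$; * 5.2 $\Delta F_{x,l}(a)+\Delta F_{x,l}(-a)=1$ for all $a\in\bar{\mathbb R}$, $x$, $l$; * 5.3 $\Delta F_{x,l}(a)=\Delta F_{x,\tilde l}(a)$ for all $a\in\bar{\mathbb R}$, $x$, $l,\tilde l$; * 5.4 $\Delta F^y_x(a)=\Delta F^{\tilde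 y}_x(a)$ for all $a\in\bar{\mathbb R}^r$, $x$, $y,\tilde y$; * 5.5 $\Delta F_x(0,\dots,0)=\tfrac12$ for all $x$. **Evaluation points.** The vector $\alpha_{x,l,U}$ lists, at positions which do not depend on $U$ and with repetitions kept: $\infty$, $-\infty$ and the cutoffs $c_{x',l'}(U)$, where $x'=x$, or $x'$ ranges over all of $\mathcal X$ if $5.1\in S$, and $l'=l$, or $l'$ ranges over all coordinates if $5.3\in S$ or $5.4\in S$; if $5.2\in S$, also the negatives of these cutoffs; if $5.2\in S$ or $5.5\in S$, also $0$. The $\pi$-ordering of a vector $\alpha\in\bar{\mathbb R}^k$ is the pair consisting of the permutation which sorts its entries from smallest to largest (ties being broken by any fixed convention) and of the sequence in $\{<,=\}^{k-1}$ of relations between successive sorted entries. **Linear program.** The linear program at $U$ has as unknowns, for every $x$, the values $\Delta\bar F_x$ at the points of the grid $\mathcal A_{x,U}$, the product over $l$ of the positions of $\alpha_{x,l,U}$. Its constraints are: the $p_{y|x}$ equal the predicted probabilities, written by inclusion and exclusion as linear combinations of grid values; $\Delta\bar F_x$ is $0$ when some entry is $-\infty$, is $1$ when all entries are $\infty$,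 has values in $[0,1]$, and is $d$-increasing (every box with vertices in the grid, and comparable lower and upper vertex, has volume $\ge0$); and the restrictions in $S$ at the grid points. **Proposition.** Let $U,\tilde U\in\mathcal U$ be such that $\alpha_{x,l,U}$ and $\alpha_{x,l,\tilde U}$ have the same $\pi$-ordering for every $l\in\{1,\dots,d\}$ and $x\in\mathcal X$. Then $$\exists\,\{\Delta F_x\}\in\Delta\mathcal F^\dagger:\ p_{y|x}=\kappa(U,\Delta F_x,y)\ \forall (x,y)\in\mathcal X\times\mathcal Y_0$$ if and only if $$\exists\,\{\Delta F_x\}\in\Delta\mathcal F^\dagger:\ p_{y|x}=\kappa(\tilde U,\Delta F_x,y)\ \forall (x,y)\in\mathcal X\times\mathcal Y_0,$$ and the linear programs at $U$ and at $\tilde U$ have the same feasible set. Only finitely many families of $\pi$-orderings occur as $U$ ranges over $\mathcal U$, so $\mathcal U$ splits into finitely many cells on each of which both the feasible set and the existence of a rationalising family are constant. -/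

import Mathlib

open MeasureTheory

noncomputable section

namespace TasteShock

/-! ### Taste-shock differences

The options of an agent are `0, 1, …, r` (`0` is the option of staying single), i.e. `Fin (r + 1)`. -/

/-- The coordinates of the vector of taste-shock differences
`Δε = (ε₁ - ε₀, …, ε_r - ε₀, ε₁ - ε₂, …, ε₁ - ε_r, ε₂ - ε₃, …, ε_{r-1} - ε_r)`.
The pair `(a, b)` stands for the coordinate `ε_a - ε_b`; there are `d = (r + 1).choose 2` of them. -/
abbrev Coord (r : ℕ) : Type :=
  {q : Fin (r + 1) × Fin (r + 1) // q.1 ≠ 0 ∧ (q.2 = 0 ∨ q.1 < q.2)}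

/-- The coordinate of `Δε` comparing the two distinct options `y` and `z`. -/
def coordOf {r : ℕ} (y z : Fin (r + 1)) (h : y ≠ z) : Coord r :=
  if hz : z = 0 then ⟨(y, z), fun hy => h (hy.trans hz.symm), Or.inl hz⟩
  else if hy : y = 0 then ⟨(z, y), hz, Or.inl hy⟩
  else if hlt : y < z then ⟨(y, z), hy, Or.inr hlt⟩
  else ⟨(z, y), hz, Or.inr (lt_of_le_of_ne (not_lt.mp hlt) (Ne.symm h))⟩

/-- The coordinates of the subvector `Δε^y` of the `r` differences that are relevant when choosing
`y`, in the order in which they appear in `Δε`: the `j`-th one compares `y` with the `j`-th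
element of `{0, …, r} \ {y}`. -/
def relevantCoord {r : ℕ} (y : Fin (r + 1)) (j : Fin r) : Coord r :=
  coordOf y (y.succAbove j) (Fin.succAbove_ne y j).symm

/-- The parameter space of systematic utilities: `U x 0 = 0` for all `x`. -/
def paramSpace (X : Type*) (r : ℕ) : Set (X → Fin (r + 1) → ℝ) :=
  {U | ∀ x, U x 0 = 0}

/-- The cutoff `U_{xb} - U_{xa}` with which the difference `ε_a - ε_b` is compared. -/
def cutoff {X : Type*} {r : ℕ} (U : X → Fin (r + 1) → ℝ) (x : X) (l : Coord r) : ℝ :=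
  U x l.1.2 - U x l.1.1

/-- The realisations of `Δε` at which option `y` is optimal for type `x`:
`U_{xy} + ε_y ≥ U_{xz} + ε_z` for all `z ≠ y`, written with the coordinates of `Δε`. -/
def choiceRegion {X : Type*} {r : ℕ} (U : X → Fin (r + 1) → ℝ) (x : X) (y : Fin (r + 1)) :
    Set (Coord r → ℝ) :=
  {e | ∀ l : Coord r, (l.1.1 = y → cutoff U x l ≤ e l) ∧ (l.1.2 = y → e l ≤ cutoff U x l)}

/-- The predicted probability that type `x` chooses `y` when `Δε` has law `μ`. -/
def choiceProb {X : Type*} {r : ℕ} (U : X → Fin (r + 1) → ℝ) (x : X)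
    (μ : Measure (Coord r → ℝ)) (y : Fin (r + 1)) : ℝ :=
  μ.real (choiceRegion U x y)

/-! ### Distributions and their nonparametric restrictions -/

/-- The joint cumulative distribution function, on the extended reals. -/
def jointCDF {ι : Type*} (μ : Measure (ι → ℝ)) (a : ι → EReal) : ℝ :=
  μ.real {e | ∀ i, (e i : EReal) ≤ a i}

/-- The `i`-th marginal cumulative distribution function, on the extended reals. -/
def marginalCDF {ι : Type*} (μ : Measure (ι → ℝ)) (i : ι) (a : EReal) : ℝ :=
  μ.real {e | (e i : EReal) ≤ a}

/-- The law of the subvector `Δε^y` when `Δε` has law `μ`. -/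
def subvectorLaw {r : ℕ} (μ : Measure (Coord r → ℝ)) (y : Fin (r + 1)) : Measure (Fin r → ℝ) :=
  μ.map (fun e j => e (relevantCoord y j))

/-- How much regularity is required of the law of `Δε`. -/
inductive Regularity where
  /-- none: any probability law on `ℝ^d` -/
  | arbitrary
  /-- the joint distribution function is continuous, i.e. the marginals have no atoms -/
  | continuous
  /-- every coordinate of `Δε` has an absolutely continuous law -/
  | acMarginals
  /-- every choice-relevant subvector of `Δε` has an absolutely continuous law on `ℝ^r` -/
  | acSubvectors

/-- The requirement named by an element of `Regularity`. -/
def Regularity.Holds {r : ℕ} (μ : Measure (Coord r → ℝ)) : Regularity → Prop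
  | .arbitrary => True
  | .continuous => ∀ (l : Coord r) (t : ℝ), μ {e | e l = t} = 0
  | .acMarginals => ∀ l : Coord r, μ.map (fun e => e l) ≪ volume
  | .acSubvectors => ∀ y : Fin (r + 1), subvectorLaw μ y ≪ volume

/-- The unrestricted class: families of probability laws on `ℝ^d` with the given regularity.
The linear relations between the coordinates of `Δε` are not imposed. -/
def IsAdmissible {X : Type*} {r : ℕ} (R : Regularity) (μ : X → Measure (Coord r → ℝ)) : Prop :=
  ∀ x, IsProbabilityMeasure (μ x) ∧ R.Holds (μ x)

/-- The names of the nonparametric restrictions. -/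
inductive Restriction where
  | independence
  | symmetry
  | identicalMarginals
  | identicalSubvectors
  | medianZero

/-- The nonparametric restrictions on a family of conditional laws of `Δε`. -/
def Restriction.Holds {X : Type*} {r : ℕ} (μ : X → Measure (Coord r → ℝ)) : Restriction → Prop
  | .independence => ∀ (a : Coord r → EReal) (x x' : X), jointCDF (μ x) a = jointCDF (μ x') a
  | .symmetry => ∀ (a : EReal) (x : X) (l : Coord r),
      marginalCDF (μ x) l a + marginalCDF (μ x) l (-a) = 1
  | .identicalMarginals => ∀ (a : EReal) (x : X) (l l' : Coord r),
      marginalCDF (μ x) l a = marginalCDF (μ x) l' a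
  | .identicalSubvectors => ∀ (a : Fin r → EReal) (x : X) (y y' : Fin (r + 1)),
      jointCDF (subvectorLaw (μ x) y) a = jointCDF (subvectorLaw (μ x) y') a
  | .medianZero => ∀ x : X, jointCDF (μ x) (fun _ => 0) = 1 / 2

/-- The restricted class of families, for a set `S` of maintained restrictions. -/
def restrictedClass (X : Type*) (r : ℕ) (R : Regularity) (S : Set Restriction) :
    Set (X → Measure (Coord r → ℝ)) :=
  {μ | IsAdmissible R μ ∧ ∀ c ∈ S, c.Holds μ}

/-- Some family in the restricted class rationalises the choice probabilities `p` at `U`. -/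
def Rationalisable {X : Type*} {r : ℕ} (R : Regularity) (S : Set Restriction)
    (p : X → Fin (r + 1) → ℝ) (U : X → Fin (r + 1) → ℝ) : Prop :=
  ∃ μ ∈ restrictedClass X r R S, ∀ (x : X) (y : Fin (r + 1)), p x y = choiceProb U x (μ x) y

/-! ### Evaluation points and their ordering -/

/-- Names for the points at which distribution functions are evaluated. -/
inductive Label (X : Type*) (r : ℕ) where
  /-- the cutoff of type `x` in coordinate `l` -/
  | cut (x : X) (l : Coord r)
  /-- minus the cutoff of type `x` in coordinate `l` -/
  | negCut (x : X) (l : Coord r)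
  | zero
  | top
  | bot

/-- The extended real number with a given name, at the utilities `U`. -/
def Label.value {X : Type*} {r : ℕ} (U : X → Fin (r + 1) → ℝ) : Label X r → EReal
  | .cut x l => ((cutoff U x l : ℝ) : EReal)
  | .negCut x l => ((-cutoff U x l : ℝ) : EReal)
  | .zero => 0
  | .top => ⊤
  | .bot => ⊥

/-- The name of the negative of a point. -/
def Label.neg {X : Type*} {r : ℕ} : Label X r → Label X r
  | .cut x l => .negCut x l
  | .negCut x l => .cut x l
  | .zero => .zero
  | .top => .bot
  | .bot => .top

/-- The points of the `l`-th evaluation set of type `x`: always the own cutoff and `±∞`; the cutoffs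
of all types if their laws have to coincide; the cutoffs in all coordinates if their laws have to
coincide (equality in law of the subvectors `Δε^y` makes all coordinates equal in law); the
negatives and `0` under symmetry; and `0` under median zero. -/
def Label.IsListed {X : Type*} {r : ℕ} (S : Set Restriction) (x : X) (l : Coord r) :
    Label X r → Prop
  | .cut x' l' => (x' = x ∨ .independence ∈ S) ∧
      (l' = l ∨ .identicalMarginals ∈ S ∨ .identicalSubvectors ∈ S)
  | .negCut x' l' => .symmetry ∈ S ∧ (x' = x ∨ .independence ∈ S) ∧
      (l' = l ∨ .identicalMarginals ∈ S ∨ .identicalSubvectors ∈ S)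
  | .zero => .symmetry ∈ S ∨ .medianZero ∈ S
  | .top => True
  | .bot => True

/-- The positions (rows) of the vector of evaluation points of type `x` in coordinate `l`. -/
abbrev Position {X : Type*} {r : ℕ} (S : Set Restriction) (x : X) (l : Coord r) : Type _ :=
  {n : Label X r // n.IsListed S x l}

/-- The vector `α_{x,l,U}` of evaluation points, possible repetitions being kept. -/
def evalPoints {X : Type*} {r : ℕ} (S : Set Restriction) (x : X) (l : Coord r)
    (U : X → Fin (r + 1) → ℝ) (n : Position S x l) : EReal :=
  n.1.value U

/-- A rule which sorts every vector indexed by `ι` from smallest to largest and reports the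
positions; ties may be broken by any convention. -/
structure SortingRule (ι : Type*) where
  /-- `order α i` is the position of the `i`-th smallest entry of `α` -/
  order : (ι → EReal) → (Fin (Nat.card ι) ≃ ι)
  monotone_order : ∀ α : ι → EReal, Monotone (fun i => α (order α i))

/-- The `π`-ordering of a vector: the sorting permutation, and for each two successive sorted
entries whether they are related by `<` (`true`) or by `=` (`false`). -/
def piOrdering {ι : Type*} (σ : SortingRule ι) (α : ι → EReal) :
    (Fin (Nat.card ι) ≃ ι) × (Fin (Nat.card ι - 1) → Bool) :=
  (σ.order α, fun i =>
    decide (α (σ.order α ⟨i.1, by omega⟩) < α (σ.order α ⟨i.1 + 1, by omega⟩)))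

/-! ### The linear program -/

/-- The grid of type `x`: the product over the coordinates of the evaluation positions. -/
abbrev Grid {X : Type*} {r : ℕ} (S : Set Restriction) (x : X) : Type _ :=
  (l : Coord r) → Position S x l

/-- The position of the own cutoff. -/
def Position.own {X : Type*} {r : ℕ} (S : Set Restriction) (x : X) (l : Coord r) :
    Position S x l :=
  ⟨.cut x l, Or.inl rfl, Or.inl rfl⟩

/-- The position of `+∞`. -/
def Position.top {X : Type*} {r : ℕ} (S : Set Restriction) (x : X) (l : Coord r) :
    Position S x l :=
  ⟨.top, trivial⟩

/-- The grid point with entry `a` in coordinate `l` and `+∞` elsewhere. -/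
def Grid.single {X : Type*} {r : ℕ} {S : Set Restriction} {x : X} (l : Coord r)
    (a : Position S x l) : Grid (r := r) S x :=
  Function.update (fun l' => Position.top S x l') l a

open Classical in
/-- The choice probability of `y` in terms of the values `f` of the joint distribution function on
the grid, by inclusion and exclusion over the lower bounds in the region where `y` is chosen. -/
def gridChoiceProb {X : Type*} {r : ℕ} {S : Set Restriction} {x : X}
    (f : Grid (r := r) S x → ℝ) (y : Fin (r + 1)) : ℝ :=
  ∑ T ∈ (Finset.univ.filter fun l : Coord r => l.1.1 = y).powerset,
    (-1 : ℝ) ^ T.card *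
      f (fun l => if l ∈ T ∨ l.1.2 = y then Position.own S x l else Position.top S x l)

open Classical in
/-- The `f`-volume of the box with lower vertex `g` and upper vertex `h`. -/
def boxVolume {X : Type*} {r : ℕ} {S : Set Restriction} {x : X}
    (f : Grid (r := r) S x → ℝ) (g h : Grid (r := r) S x) : ℝ :=
  ∑ T : Finset (Coord r), (-1 : ℝ) ^ T.card * f (fun l => if l ∈ T then g l else h l)

/-- The linear constraints expressing that `f` is a subdistribution on the grid at `U`. -/
def IsSubdistribution {X : Type*} {r : ℕ} {S : Set Restriction} {x : X}
    (U : X → Fin (r + 1) → ℝ) (f : Grid (r := r) S x → ℝ) : Prop :=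
  (∀ g : Grid (r := r) S x, (∃ l, (g l).1 = .bot) → f g = 0) ∧
  f (fun l => Position.top S x l) = 1 ∧
  (∀ g, 0 ≤ f g ∧ f g ≤ 1) ∧
  ∀ g h : Grid (r := r) S x,
    (∀ l, evalPoints S x l U (g l) ≤ evalPoints S x l U (h l)) → 0 ≤ boxVolume f g h

/-- The linear constraints on the grid values that express a nonparametric restriction. -/
def Restriction.GridHolds {X : Type*} {r : ℕ} {S : Set Restriction}
    (f : (x : X) → Grid (r := r) S x → ℝ) : Restriction → Prop
  | .independence => ∀ (x x' : X) (g : Grid (r := r) S x) (g' : Grid (r := r) S x'),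
      (∀ l, (g l).1 = (g' l).1) → f x g = f x' g'
  | .symmetry => ∀ (x : X) (l : Coord r) (a a' : Position S x l),
      a'.1 = a.1.neg → f x (Grid.single l a) + f x (Grid.single l a') = 1
  | .identicalMarginals => ∀ (x : X) (l l' : Coord r) (a : Position S x l) (a' : Position S x l'),
      a.1 = a'.1 → f x (Grid.single l a) = f x (Grid.single l' a')
  | .identicalSubvectors => ∀ (x : X) (y y' : Fin (r + 1)) (g g' : Grid (r := r) S x),
      (∀ j, (g (relevantCoord y j)).1 = (g' (relevantCoord y' j)).1) →
      (∀ l, l ∉ Set.range (relevantCoord y) → (g l).1 = .top) →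
      (∀ l, l ∉ Set.range (relevantCoord y') → (g' l).1 = .top) → f x g = f x g'
  | .medianZero => ∀ (x : X) (g : Grid (r := r) S x), (∀ l, (g l).1 = .zero) → f x g = 1 / 2

/-- The feasible set of the linear program at `U`: all families of vectors of grid values which match
the choice probabilities `p`, are subdistributions, and satisfy the restrictions in `S`. -/
def feasibleSet {X : Type*} {r : ℕ} (S : Set Restriction) (p : X → Fin (r + 1) → ℝ)
    (U : X → Fin (r + 1) → ℝ) : Set ((x : X) → Grid (r := r) S x → ℝ) :=
  {f | (∀ x y, p x y = gridChoiceProb (f x) y) ∧ (∀ x, IsSubdistribution U (f x)) ∧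
    ∀ c ∈ S, c.GridHolds f}

end TasteShock

end

/-! Equal `π`-orderings mean that the evaluation points at `U'` and at `U` are arranged in the same
weak order, so for each type and coordinate an increasing bijection `ψ` of the line carries the
points at `U'` to those at `U` (`exists_isTransport`). If a law with distribution function `F`
rationalises the data at `U`, its image under the coordinatewise inverses of the `ψ` has
distribution function `a ↦ F (ψ a)` and gives the same choice probabilities at `U'`. Moving the
coordinates separately is harmless because no linear relation between them is imposed.

The restrictions survive if `ψ` is compatible with them: independent of the type or of the
coordinate where laws must coincide, odd under symmetry, fixing `0` under median zero. The choice of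
evaluation points makes this possible. Absolute continuity survives because `ψ` is Lipschitz, so
that it maps null sets to null sets.

In the linear program `U` enters only through the order of box vertices. Finiteness holds because
there are finitely many permutations and relation sequences. -/

/-! ### Increasing bijections of the line and finite interpolation. -/

open Filter Topology in
-- Both `ψ` and `t ↦ -ψ (-t)` are increasing, Lipschitz and unbounded in both directions; so is
-- their average, which is therefore a bijection. Being odd, it serves the symmetry restriction.
theorem OrderIso.exists_odd_part (ψ : ℝ ≃o ℝ) {K : NNReal} (hψ : LipschitzWith K ψ) :
    ∃ φ : ℝ ≃o ℝ, (∃ K, LipschitzWith K φ) ∧ ∀ t, φ t = (ψ t - ψ (-t)) / 2 := by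
  have hlip : LipschitzWith ((K + K * 1) * ‖(1 / 2 : ℝ)‖₊) fun t => (ψ t - ψ (-t)) / 2 := by
    refine LipschitzWith.of_dist_le_mul fun s t => ?_
    have h₁ := hψ.dist_le_mul s t
    have h₂ := hψ.dist_le_mul (-s) (-t)
    rw [dist_neg_neg] at h₂
    simp only [Real.dist_eq] at h₁ h₂ ⊢
    push_cast
    have h₃ : (ψ s - ψ (-s)) / 2 - (ψ t - ψ (-t)) / 2
        = ((ψ s - ψ t) - (ψ (-s) - ψ (-t))) / 2 := by ring
    have h₄ := abs_sub (ψ s - ψ t) (ψ (-s) - ψ (-t))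
    rw [h₃, abs_div]
    norm_num
    linarith
  have hmono : StrictMono fun t => (ψ t - ψ (-t)) / 2 := fun s t hst => by
    have h₁ := ψ.strictMono hst
    have h₂ := ψ.strictMono (neg_lt_neg hst)
    simp only
    linarith
  have hsurj : Function.Surjective fun t => (ψ t - ψ (-t)) / 2 := by
    refine hlip.continuous.surjective ?_ ?_
    · refine Tendsto.atTop_div_const two_pos ?_
      simp only [sub_eq_add_neg]
      exact ψ.tendsto_atTop.atTop_add_atTop
        (tendsto_neg_atBot_atTop.comp (ψ.tendsto_atBot.comp tendsto_neg_atTop_atBot))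
    · refine Tendsto.atBot_div_const two_pos ?_
      simp only [sub_eq_add_neg]
      exact ψ.tendsto_atBot.atBot_add_atBot
        (tendsto_neg_atTop_atBot.comp (ψ.tendsto_atTop.comp tendsto_neg_atBot_atTop))
  exact ⟨hmono.orderIsoOfSurjective _ hsurj, ⟨_, hlip⟩, fun t => rfl⟩

/-- The piecewise linear map of the line with slope `1` below `p` and slope `s` above. -/
theorem OrderIso.exists_kink (p s : ℝ) (hs : 0 < s) :
    ∃ φ : ℝ ≃o ℝ, (∃ K, LipschitzWith K φ) ∧ (∀ t ≤ p, φ t = t) ∧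
      ∀ t, p ≤ t → φ t = p + s * (t - p) := by
  have hlow : ∀ t ≤ p, min t p + s * max (t - p) 0 = t := fun t ht => by
    rw [min_eq_left ht, max_eq_right (by linarith)]; ring
  have hhigh : ∀ t, p ≤ t → min t p + s * max (t - p) 0 = p + s * (t - p) := fun t ht => by
    rw [min_eq_right ht, max_eq_left (by linarith)]
  have hmono : StrictMono fun t => min t p + s * max (t - p) 0 := fun t u htu => by
    simp only
    rcases le_total u p with hu | hu
    · rwa [hlow u hu, hlow t (htu.le.trans hu)]
    · rcases le_total t p with ht | ht
      · rw [hlow t ht, hhigh u hu]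
        rcases ht.lt_or_eq with ht | rfl
        · nlinarith [mul_nonneg hs.le (sub_nonneg.2 hu)]
        · nlinarith [mul_pos hs (sub_pos.2 htu)]
      · rw [hhigh t ht, hhigh u hu]
        nlinarith [mul_pos hs (sub_pos.2 htu)]
  have hsurj : Function.Surjective fun t => min t p + s * max (t - p) 0 := fun y => by
    rcases le_total y p with hy | hy
    · exact ⟨y, hlow y hy⟩
    · refine ⟨p + (y - p) / s, (hhigh _ ?_).trans ?_⟩
      · have := div_nonneg (sub_nonneg.2 hy) hs.le
        linarith
      · field_simp
        ring
  refine ⟨hmono.orderIsoOfSurjective _ hsurj, ⟨1 + ‖s‖₊ * (1 + 0), ?_⟩, hlow, hhigh⟩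
  exact (LipschitzWith.id.min_const p).add
    ((lipschitzWith_smul s).comp
      ((LipschitzWith.id.sub (LipschitzWith.const p)).max_const 0))

/-- A strictly increasing map between finite sets of reals extends to a Lipschitz increasing
bijection of the line. -/
theorem exists_lipschitz_orderIso {ι : Type*} (s : Finset ι) (u w : ι → ℝ)
    (h : ∀ i ∈ s, ∀ j ∈ s, u i < u j ↔ w i < w j) :
    ∃ ψ : ℝ ≃o ℝ, (∃ K, LipschitzWith K ψ) ∧ ∀ i ∈ s, ψ (u i) = w i := by
  classical
  induction s using Finset.induction_on_max_value u with
  | empty => exact ⟨OrderIso.refl ℝ, ⟨1, LipschitzWith.id⟩, by simp⟩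
  | insert a s _ hmax ih =>
    obtain ⟨ψ, ⟨K, hK⟩, hψ⟩ := ih fun i hi j hj =>
      h i (Finset.mem_insert_of_mem hi) j (Finset.mem_insert_of_mem hj)
    rcases s.eq_empty_or_nonempty with rfl | hs
    · refine ⟨OrderIso.addRight (w a - u a), ⟨1 + 0, ?_⟩, by simp⟩
      exact LipschitzWith.id.add (LipschitzWith.const (w a - u a))
    obtain ⟨m, hm, hmm⟩ := s.exists_max_image u hs
    have ham := h m (Finset.mem_insert_of_mem hm) a (Finset.mem_insert_self a s)
    have hma := h a (Finset.mem_insert_self a s) m (Finset.mem_insert_of_mem hm)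
    -- `m` attains the previous maximum. In a tie the hypothesis forces `w a = w m`, and `ψ` already
    -- works.
    rcases (hmax m hm).eq_or_lt with hua | hua
    · refine ⟨ψ, ⟨K, hK⟩, fun i hi => ?_⟩
      rcases Finset.mem_insert.1 hi with rfl | hi
      · rw [← hua, hψ m hm]
        rw [← hua] at ham hma
        exact le_antisymm (not_lt.1 fun hlt => lt_irrefl _ (hma.2 hlt))
          (not_lt.1 fun hlt => lt_irrefl _ (ham.2 hlt))
      · exact hψ i hi
    · have hψa : w m < ψ (u a) := by
        rw [← hψ m hm]
        exact ψ.strictMono hua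
      -- This slope sends `ψ (u a)` to `w a`; the earlier values are at most `w m`, hence fixed by
      -- the kinked map.
      obtain ⟨φ, ⟨K', hK'⟩, hlow, hhigh⟩ :=
        OrderIso.exists_kink (w m) ((w a - w m) / (ψ (u a) - w m))
          (div_pos (sub_pos.2 (ham.1 hua)) (sub_pos.2 hψa))
      refine ⟨ψ.trans φ, ⟨K' * K, hK'.comp hK⟩, fun i hi => ?_⟩
      rw [OrderIso.trans_apply]
      rcases Finset.mem_insert.1 hi with rfl | hi
      · rw [hhigh _ hψa.le, div_mul_cancel₀ _ (sub_pos.2 hψa).ne']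
        ring
      · rw [hψ i hi]
        refine hlow _ ?_
        rw [← hψ i hi, ← hψ m hm]
        exact ψ.monotone (hmm i hi)

/-- A `π`-ordering records only successive relations. If `g` does not increase from `i` to `j`, it
has no strict step in between, so neither does `f`, which is then constant there. -/
theorem lt_iff_lt_of_adjacent_lt_iff {α : Type*} [LinearOrder α] {n : ℕ} {f g : Fin n → α}
    (hf : Monotone f) (hg : Monotone g)
    (h : ∀ i (hi : i + 1 < n), f ⟨i, by omega⟩ < f ⟨i + 1, hi⟩ ↔ g ⟨i, by omega⟩ < g ⟨i + 1, hi⟩)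
    (i j : Fin n) : f i < f j ↔ g i < g j := by
  have key : ∀ f g : Fin n → α, Monotone f → Monotone g →
      (∀ i (hi : i + 1 < n), f ⟨i, by omega⟩ < f ⟨i + 1, hi⟩ → g ⟨i, by omega⟩ < g ⟨i + 1, hi⟩) →
      f i < f j → g i < g j := by
    intro f g hf hg h hij
    by_contra hle
    rw [not_lt] at hle
    have hlt : i < j := hf.reflect_lt hij
    have hconst : ∀ k, i.1 ≤ k → ∀ hk : k ≤ j.1, f ⟨k, by omega⟩ ≤ f i := by
      intro k hik
      induction k, hik using Nat.le_induction with
      | base => exact fun _ => le_rfl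
      | succ k hik ih =>
        intro hk
        refine le_trans (not_lt.1 fun hlt' => ?_) (ih (by omega))
        refine (h k (by omega) hlt').not_ge ?_
        exact (hg (show (⟨k + 1, by omega⟩ : Fin n) ≤ j from hk)).trans
          (hle.trans (hg (show i ≤ (⟨k, by omega⟩ : Fin n) from hik)))
    exact (hconst j.1 hlt.le le_rfl).not_gt hij
  exact ⟨key f g hf hg fun i hi => (h i hi).1, key g f hg hf fun i hi => (h i hi).2⟩

/-! ### Coordinatewise transport and null sets. -/

/-- The extension of an increasing bijection of the line to the extended reals. -/
def OrderIso.erealExtend (ψ : ℝ ≃o ℝ) : EReal → EReal :=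
  WithBot.map (WithTop.map ψ)

theorem OrderIso.erealExtend_coe (ψ : ℝ ≃o ℝ) (t : ℝ) :
    ψ.erealExtend (t : EReal) = (ψ t : ℝ) := rfl

theorem OrderIso.coe_symm_le_iff (ψ : ℝ ≃o ℝ) (t : ℝ) (a : EReal) :
    ((ψ.symm t : ℝ) : EReal) ≤ a ↔ (t : EReal) ≤ ψ.erealExtend a := by
  induction a with
  | bot => exact iff_of_false (by simp) (not_le.2 (EReal.bot_lt_coe t))
  | top => exact iff_of_true le_top le_top
  | coe a =>
    rw [OrderIso.erealExtend_coe, EReal.coe_le_coe_iff, EReal.coe_le_coe_iff]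
    exact ψ.symm_apply_le

theorem OrderIso.erealExtend_neg {ψ : ℝ ≃o ℝ} (h : ∀ t, ψ (-t) = -ψ t) (a : EReal) :
    ψ.erealExtend (-a) = -ψ.erealExtend a := by
  induction a with
  | bot => rfl
  | top => rfl
  | coe a =>
    rw [← EReal.coe_neg, OrderIso.erealExtend_coe, OrderIso.erealExtend_coe, h, EReal.coe_neg]

/-- The inverses of increasing bijections of the line, applied coordinate by coordinate. -/
def coordwiseSymm {ι : Type*} (ψ : ι → ℝ ≃o ℝ) (e : ι → ℝ) : ι → ℝ :=
  fun i => (ψ i).symm (e i)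

theorem measurable_coordwiseSymm {ι : Type*} (ψ : ι → ℝ ≃o ℝ) :
    Measurable (coordwiseSymm ψ) :=
  measurable_pi_lambda _ fun i => (ψ i).symm.continuous.measurable.comp (measurable_pi_apply i)

/-- The preimage of a null set `N` under the inverses is its image under the `ψ i`. Lebesgue measure
is Hausdorff measure of full dimension, and a Lipschitz map enlarges that by at most a constant
factor. -/
theorem absolutelyContinuous_map_coordwiseSymm {ι : Type*} [Fintype ι] {ψ : ι → ℝ ≃o ℝ}
    (hψ : ∀ i, ∃ K, LipschitzWith K (ψ i)) {ν : Measure (ι → ℝ)} (hν : ν ≪ volume) :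
    ν.map (coordwiseSymm ψ) ≪ volume := by
  choose K hK using hψ
  refine Measure.AbsolutelyContinuous.mk fun N hN hN0 => ?_
  rw [Measure.map_apply (measurable_coordwiseSymm ψ) hN]
  apply hν
  have hlip : LipschitzWith (Finset.univ.sup K) fun (e : ι → ℝ) i => ψ i (e i) := by
    refine LipschitzWith.of_dist_le_mul fun e e' => ?_
    refine (dist_pi_le_iff (by positivity)).2 fun i => ((hK i).dist_le_mul _ _).trans ?_
    refine mul_le_mul ?_ (dist_le_pi_dist e e' i) dist_nonneg (by positivity)
    exact_mod_cast Finset.le_sup (f := K) (Finset.mem_univ i)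
  have himage : coordwiseSymm ψ ⁻¹' N ⊆ (fun (e : ι → ℝ) i => ψ i (e i)) '' N := fun e he =>
    ⟨_, he, funext fun i => (ψ i).apply_symm_apply (e i)⟩
  refine measure_mono_null himage ?_
  rw [← hausdorffMeasure_pi_real] at hN0 ⊢
  refine le_antisymm ((hlip.hausdorffMeasure_image_le (by positivity) N).trans ?_) zero_le
  rw [hN0, mul_zero]

theorem absolutelyContinuous_map_symm {ψ : ℝ ≃o ℝ} (hψ : ∃ K, LipschitzWith K ψ)
    {ν : Measure ℝ} (hν : ν ≪ volume) : ν.map ψ.symm ≪ volume := by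
  obtain ⟨K, hK⟩ := hψ
  refine Measure.AbsolutelyContinuous.mk fun N hN hN0 => ?_
  rw [Measure.map_apply ψ.symm.continuous.measurable hN]
  apply hν
  refine measure_mono_null (t := ψ '' N) (fun t ht => ⟨_, ht, ψ.apply_symm_apply t⟩) ?_
  rw [← hausdorffMeasure_real] at hN0 ⊢
  refine le_antisymm ((hK.hausdorffMeasure_image_le zero_le_one N).trans ?_) zero_le
  rw [hN0, mul_zero]

/-! ### Effect of transport on laws, restrictions and choice probabilities. -/

namespace TasteShock

variable {X : Type*} {r : ℕ}

instance [Finite X] : Finite (Label X r) :=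
  Finite.of_surjective
    (fun c : (X × Coord r) ⊕ (X × Coord r) ⊕ Fin 3 => match c with
      | .inl c => Label.cut c.1 c.2
      | .inr (.inl c) => Label.negCut c.1 c.2
      | .inr (.inr 0) => Label.zero
      | .inr (.inr 1) => Label.top
      | .inr (.inr 2) => Label.bot)
    fun n => match n with
      | .cut x l => ⟨.inl (x, l), rfl⟩
      | .negCut x l => ⟨.inr (.inl (x, l)), rfl⟩
      | .zero => ⟨.inr (.inr 0), rfl⟩
      | .top => ⟨.inr (.inr 1), rfl⟩
      | .bot => ⟨.inr (.inr 2), rfl⟩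

theorem jointCDF_map_coordwiseSymm {ι : Type*} [Countable ι] (ψ : ι → ℝ ≃o ℝ)
    (μ : Measure (ι → ℝ)) (a : ι → EReal) :
    jointCDF (μ.map (coordwiseSymm ψ)) a = jointCDF μ fun i => (ψ i).erealExtend (a i) := by
  have hmeas : MeasurableSet {e : ι → ℝ | ∀ i, (e i : EReal) ≤ a i} := by
    rw [Set.ofPred_forall]
    exact MeasurableSet.iInter fun i =>
      measurableSet_le (measurable_coe_real_ereal.comp (measurable_pi_apply i)) measurable_const
  rw [jointCDF, map_measureReal_apply (measurable_coordwiseSymm ψ) hmeas, jointCDF]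
  congr 1
  ext e
  exact forall_congr' fun i => (ψ i).coe_symm_le_iff (e i) (a i)

theorem marginalCDF_map_coordwiseSymm {ι : Type*} (ψ : ι → ℝ ≃o ℝ)
    (μ : Measure (ι → ℝ)) (i : ι) (a : EReal) :
    marginalCDF (μ.map (coordwiseSymm ψ)) i a = marginalCDF μ i ((ψ i).erealExtend a) := by
  have hmeas : MeasurableSet {e : ι → ℝ | (e i : EReal) ≤ a} :=
    measurableSet_le (measurable_coe_real_ereal.comp (measurable_pi_apply i)) measurable_const
  rw [marginalCDF, map_measureReal_apply (measurable_coordwiseSymm ψ) hmeas, marginalCDF]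
  congr 1
  ext e
  exact (ψ i).coe_symm_le_iff (e i) a

theorem subvectorLaw_map_coordwiseSymm (ψ : Coord r → ℝ ≃o ℝ) (μ : Measure (Coord r → ℝ))
    (y : Fin (r + 1)) :
    subvectorLaw (μ.map (coordwiseSymm ψ)) y =
      (subvectorLaw μ y).map (coordwiseSymm fun j => ψ (relevantCoord y j)) := by
  have hsub : Measurable fun (e : Coord r → ℝ) (j : Fin r) => e (relevantCoord y j) :=
    measurable_pi_lambda _ fun j => measurable_pi_apply _
  rw [subvectorLaw, subvectorLaw, Measure.map_map hsub (measurable_coordwiseSymm ψ),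
    Measure.map_map (measurable_coordwiseSymm _) hsub]
  rfl

theorem Regularity.Holds.map_coordwiseSymm {R : Regularity} {μ : Measure (Coord r → ℝ)}
    (h : R.Holds μ) {ψ : Coord r → ℝ ≃o ℝ} (hψ : ∀ l, ∃ K, LipschitzWith K (ψ l)) :
    R.Holds (μ.map (coordwiseSymm ψ)) := by
  have hmeas := measurable_coordwiseSymm ψ
  cases R with
  | arbitrary => trivial
  | continuous =>
    intro l t
    rw [Measure.map_apply hmeas (measurableSet_eq_fun (measurable_pi_apply l) measurable_const)]
    refine measure_mono_null (fun e he => ?_) (h l (ψ l t))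
    exact (ψ l).symm_apply_eq.1 he
  | acMarginals =>
    intro l
    have := absolutelyContinuous_map_symm (hψ l) (h l)
    rw [Measure.map_map (ψ l).symm.continuous.measurable (measurable_pi_apply l)] at this
    rwa [Measure.map_map (measurable_pi_apply l) hmeas]
  | acSubvectors =>
    intro y
    rw [subvectorLaw_map_coordwiseSymm]
    exact absolutelyContinuous_map_coordwiseSymm (fun j => hψ _) (h y)

/-- A choice region is cut out by comparing each coordinate with its cutoff, and an increasing
bijection matching the cutoffs preserves these comparisons. -/
theorem choiceProb_map_coordwiseSymm {U U' : X → Fin (r + 1) → ℝ} {x : X}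
    {ψ : Coord r → ℝ ≃o ℝ} (hψ : ∀ l, ψ l (cutoff U' x l) = cutoff U x l)
    (μ : Measure (Coord r → ℝ)) (y : Fin (r + 1)) :
    choiceProb U' x (μ.map (coordwiseSymm ψ)) y = choiceProb U x μ y := by
  have hmeas : MeasurableSet (choiceRegion U' x y) := by
    simp only [choiceRegion, Set.ofPred_forall, Set.ofPred_and]
    refine MeasurableSet.iInter fun l => MeasurableSet.inter ?_ ?_ <;>
      refine MeasurableSet.iInter fun _ => ?_
    · exact measurableSet_le measurable_const (measurable_pi_apply l)
    · exact measurableSet_le (measurable_pi_apply l) measurable_const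
  rw [choiceProb, map_measureReal_apply (measurable_coordwiseSymm ψ) hmeas, choiceProb]
  congr 1
  ext e
  refine forall_congr' fun l => ?_
  rw [← hψ l, coordwiseSymm, (ψ l).le_symm_apply, (ψ l).symm_apply_le]

/-- Increasing bijections of the line, one for each type and coordinate, which respect the
restrictions in `S` and carry the cutoffs at `U'` to the cutoffs at `U`. -/
structure IsTransport (S : Set Restriction) (U U' : X → Fin (r + 1) → ℝ)
    (ψ : X → Coord r → ℝ ≃o ℝ) : Prop where
  lipschitz : ∀ x l, ∃ K, LipschitzWith K (ψ x l)
  cutoff : ∀ x l, ψ x l (cutoff U' x l) = cutoff U x l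
  independence : .independence ∈ S → ∀ x x' l, ψ x l = ψ x' l
  identical : .identicalMarginals ∈ S ∨ .identicalSubvectors ∈ S → ∀ x l l', ψ x l = ψ x l'
  symmetry : .symmetry ∈ S → ∀ x l t, ψ x l (-t) = -ψ x l t
  medianZero : .medianZero ∈ S → ∀ x l, ψ x l 0 = 0

/-- Each restriction relates values of distribution functions at certain points, and a compatible
`ψ` merely reparametrises these points. -/
theorem IsTransport.restriction_holds {S : Set Restriction} {U U' : X → Fin (r + 1) → ℝ}
    {ψ : X → Coord r → ℝ ≃o ℝ} (hψ : IsTransport S U U' ψ) {μ : X → Measure (Coord r → ℝ)}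
    {c : Restriction} (hc : c ∈ S) (h : c.Holds μ) :
    c.Holds fun x => (μ x).map (coordwiseSymm (ψ x)) := by
  cases c with
  | independence =>
    intro a x x'
    simp only [jointCDF_map_coordwiseSymm]
    rw [show ψ x = ψ x' from funext (hψ.independence hc x x')]
    exact h _ x x'
  | symmetry =>
    intro a x l
    simp only [marginalCDF_map_coordwiseSymm]
    rw [OrderIso.erealExtend_neg (hψ.symmetry hc x l)]
    exact h _ x l
  | identicalMarginals =>
    intro a x l l'
    simp only [marginalCDF_map_coordwiseSymm]
    rw [hψ.identical (.inl hc) x l l']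
    exact h _ x l l'
  | identicalSubvectors =>
    intro a x y y'
    simp only [subvectorLaw_map_coordwiseSymm, jointCDF_map_coordwiseSymm]
    rw [show (fun j => (ψ x (relevantCoord y j)).erealExtend (a j)) =
      fun j => (ψ x (relevantCoord y' j)).erealExtend (a j) from
        funext fun j => by rw [hψ.identical (.inr hc) x]]
    exact h _ x y y'
  | medianZero =>
    intro x
    simp only [jointCDF_map_coordwiseSymm]
    rw [show (fun l => (ψ x l).erealExtend 0) = fun _ => 0 from funext fun l => by
      rw [← EReal.coe_zero, OrderIso.erealExtend_coe, hψ.medianZero hc]]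
    exact h x

theorem Rationalisable.of_isTransport {R : Regularity} {S : Set Restriction}
    {p U U' : X → Fin (r + 1) → ℝ} {ψ : X → Coord r → ℝ ≃o ℝ} (hψ : IsTransport S U U' ψ)
    (h : Rationalisable R S p U) : Rationalisable R S p U' := by
  obtain ⟨μ, ⟨hadm, hS⟩, hp⟩ := h
  refine ⟨fun x => (μ x).map (coordwiseSymm (ψ x)), ⟨fun x => ⟨?_, ?_⟩, fun c hc => ?_⟩,
    fun x y => ?_⟩
  · have := (hadm x).1
    exact Measure.isProbabilityMeasure_map (measurable_coordwiseSymm _).aemeasurable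
  · exact (hadm x).2.map_coordwiseSymm (hψ.lipschitz x)
  · exact hψ.restriction_holds hc (hS c hc)
  · rw [hp x y, choiceProb_map_coordwiseSymm (hψ.cutoff x)]

/-! ### From equal orderings to a transport. -/

theorem Label.value_neg (U : X → Fin (r + 1) → ℝ) (n : Label X r) :
    n.neg.value U = -n.value U := by
  cases n <;> simp [Label.neg, Label.value]

/-- The utilities `U` and `U'` induce the same weak order on the evaluation points named in `L`. -/
def SameOrder (U U' : X → Fin (r + 1) → ℝ) (L : Set (Label X r)) : Prop :=
  ∀ n ∈ L, ∀ m ∈ L, n.value U < m.value U ↔ n.value U' < m.value U'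

theorem SameOrder.symm {U U' : X → Fin (r + 1) → ℝ} {L : Set (Label X r)}
    (h : SameOrder U U' L) : SameOrder U' U L :=
  fun n hn m hm => (h n hn m hm).symm

theorem SameOrder.exists_orderIso [Finite X] {U U' : X → Fin (r + 1) → ℝ} {L : Set (Label X r)}
    (h : SameOrder U U' L) :
    ∃ ψ : ℝ ≃o ℝ, (∃ K, LipschitzWith K ψ) ∧
      (∀ n ∈ L, ∀ s t : ℝ, n.value U' = s → n.value U = t → ψ s = t) ∧
      ((∀ n ∈ L, n.neg ∈ L) → ∀ t, ψ (-t) = -ψ t) := by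
  -- `toReal` sends `±∞` to `0`, so the names of the infinite points are left out of the
  -- interpolation.
  have hreal : ∀ n : Label X r, n ≠ .top → n ≠ .bot → ∀ V : X → Fin (r + 1) → ℝ,
      (((n.value V).toReal : ℝ) : EReal) = n.value V := by
    intro n htop hbot V
    cases n with
    | top => exact absurd rfl htop
    | bot => exact absurd rfl hbot
    | _ => simp [Label.value]
  obtain ⟨ψ, ⟨K, hK⟩, hψ⟩ := exists_lipschitz_orderIso
    (Set.toFinite {n | n ∈ L ∧ n ≠ .top ∧ n ≠ .bot}).toFinset
    (fun n => (n.value U').toReal) (fun n => (n.value U).toReal) (by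
      intro n hn m hm
      simp only [Set.Finite.mem_toFinset, Set.mem_ofPred_eq] at hn hm
      rw [← EReal.coe_lt_coe_iff, ← EReal.coe_lt_coe_iff]
      simp only [hreal n hn.2.1 hn.2.2, hreal m hm.2.1 hm.2.2]
      exact (h n hn.1 m hm.1).symm)
  have hval : ∀ n ∈ L, ∀ s t : ℝ, n.value U' = s → n.value U = t → ψ s = t := by
    intro n hn s t hs ht
    have := hψ n (by
      simp only [Set.Finite.mem_toFinset, Set.mem_ofPred_eq]
      refine ⟨hn, ?_, ?_⟩ <;> rintro rfl <;> simp [Label.value] at hs)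
    rwa [hs, ht] at this
  by_cases hneg : ∀ n ∈ L, n.neg ∈ L
  -- Passing to the odd part keeps the prescribed values, since `ψ` also carries the negative of
  -- each point to the negative of its target.
  · obtain ⟨φ, hφ, hφψ⟩ := ψ.exists_odd_part hK
    refine ⟨φ, hφ, fun n hn s t hs ht => ?_, fun _ t => ?_⟩
    · rw [hφψ, hval n hn s t hs ht, hval n.neg (hneg n hn) (-s) (-t)]
      · ring
      · rw [Label.value_neg, hs, EReal.coe_neg]
      · rw [Label.value_neg, ht, EReal.coe_neg]
    · rw [hφψ, hφψ, neg_neg]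
      ring
  · exact ⟨ψ, ⟨K, hK⟩, hval, fun h => absurd h hneg⟩

theorem Label.IsListed.neg {S : Set Restriction} (hS : .symmetry ∈ S) {x : X} {l : Coord r}
    {n : Label X r} (hn : n.IsListed S x l) : n.neg.IsListed S x l := by
  cases n with
  | cut x' l' => exact ⟨hS, hn⟩
  | negCut x' l' => exact hn.2
  | zero => exact hn
  | top => trivial
  | bot => trivial

theorem exists_isTransport [Finite X] {S : Set Restriction} {U U' : X → Fin (r + 1) → ℝ}
    (h : ∀ x l, SameOrder U U' {n | n.IsListed S x l}) :
    ∃ ψ, IsTransport S U U' ψ := by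
  have hex := fun (L : Set (Label X r)) (hL : SameOrder U U' L) => hL.exists_orderIso
  -- The bijection is chosen as a function of the set of names alone. Types or coordinates whose
  -- lists coincide thus receive the same bijection, as the independence and identical-law
  -- restrictions require.
  choose! ψ hlip hval hodd using hex
  refine ⟨fun x l => ψ {n | n.IsListed S x l}, ⟨fun x l => hlip _ (h x l), fun x l => ?_,
    fun hS x x' l => ?_, fun hS x l l' => ?_, fun hS x l => ?_, fun hS x l => ?_⟩⟩
  · exact hval _ (h x l) (.cut x l) ⟨.inl rfl, .inl rfl⟩ _ _ rfl rfl
  · congr 1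
    ext n
    cases n <;> simp [Label.IsListed, hS]
  · congr 1
    ext n
    cases n <;> simp [Label.IsListed, hS]
  · exact hodd _ (h x l) fun n hn => hn.neg hS
  · exact hval _ (h x l) .zero (.inr hS) _ _ rfl rfl

theorem sameOrder_of_piOrdering_eq {S : Set Restriction} {U U' : X → Fin (r + 1) → ℝ} {x : X}
    {l : Coord r} (σ : SortingRule (Position S x l))
    (h : piOrdering σ (evalPoints S x l U) = piOrdering σ (evalPoints S x l U')) :
    SameOrder U U' {n | n.IsListed S x l} := by
  obtain ⟨hord, hrel⟩ := Prod.ext_iff.1 h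
  simp only [piOrdering] at hord hrel
  have hU := σ.monotone_order (evalPoints S x l U)
  have hU' := σ.monotone_order (evalPoints S x l U')
  -- Both vectors are now sorted by one permutation, so only successive relations remain to be
  -- compared.
  rw [← hord] at hrel hU'
  intro n hn m hm
  obtain ⟨i, hi⟩ := (σ.order (evalPoints S x l U)).surjective ⟨n, hn⟩
  obtain ⟨j, hj⟩ := (σ.order (evalPoints S x l U)).surjective ⟨m, hm⟩
  have key := lt_iff_lt_of_adjacent_lt_iff hU hU' (fun i hi => by
    simpa using congrFun hrel ⟨i, by omega⟩) i j
  simp only [hi, hj] at key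
  exact key

/-- Grid points are indexed by names, so only the comparability of box vertices involves the
utilities. -/
theorem feasibleSet_subset_of_sameOrder {S : Set Restriction} {p U U' : X → Fin (r + 1) → ℝ}
    (h : ∀ x l, SameOrder U U' {n | n.IsListed S x l}) :
    feasibleSet S p U ⊆ feasibleSet S p U' := by
  refine fun f hf => ⟨hf.1, fun x => ?_, hf.2.2⟩
  obtain ⟨hbot, htop, hrange, hbox⟩ := hf.2.1 x
  refine ⟨hbot, htop, hrange, fun g g' hle => hbox g g' fun l => ?_⟩
  have := h x l _ (g' l).2 _ (g l).2
  exact not_lt.1 fun hlt => (hle l).not_gt (this.1 hlt)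

end TasteShock

open TasteShock in
theorem proposition3 {X : Type*} [Finite X] (r : ℕ) (R : Regularity) (S : Set Restriction)
    (p : X → Fin (r + 1) → ℝ)
    (σ : ∀ (x : X) (l : Coord r), SortingRule (Position S x l)) :
    (∀ U ∈ paramSpace X r, ∀ U' ∈ paramSpace X r,
      (∀ (x : X) (l : Coord r), piOrdering (σ x l) (evalPoints S x l U) =
        piOrdering (σ x l) (evalPoints S x l U')) →
      (Rationalisable R S p U ↔ Rationalisable R S p U') ∧
        feasibleSet S p U = feasibleSet S p U') ∧
    ((fun (U : X → Fin (r + 1) → ℝ) (x : X) (l : Coord r) =>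
      piOrdering (σ x l) (evalPoints S x l U)) '' paramSpace X r).Finite := by
  refine ⟨fun U _ U' _ h => ?_, Set.toFinite _⟩
  have hsame : ∀ x l, SameOrder U U' {n | n.IsListed S x l} := fun x l =>
    sameOrder_of_piOrdering_eq (σ x l) (h x l)
  have hsame' := fun x l => (hsame x l).symm
  obtain ⟨ψ, hψ⟩ := exists_isTransport hsame
  obtain ⟨ψ', hψ'⟩ := exists_isTransport hsame'
  exact ⟨⟨.of_isTransport hψ, .of_isTransport hψ'⟩,
    (feasibleSet_subset_of_sameOrder hsame).antisymm (feasibleSet_subset_of_sameOrder hsame')⟩
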